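/- **Holevo information stability from quantum local differential privacy (QLDP).** All Hilbert spaces are finite-dimensional and $\log$ is the natural logarithm. A state on $\mathcal H$ is a positive semidefinite operator of unit trace, and a quantum channel is a completely positive, trace-preserving linear map. Let $\varepsilon \ge 0$. A channel $\mathcal A_{A\to B}$ satisfies $\varepsilon$-QLDP if $$\operatorname{Tr}[M\mathcal A(\rho)] \le e^{\varepsilon}\operatorname{Tr}[M\mathcal A(\sigma)]$$ for all states $\rho,\sigma$ on $\mathcal H_A$ and all operators $M$ on $\mathcal H_B$ with $0\le M\le I$. The quantum relative entropy is $D(\rho\|\sigma)=\operatorname{Tr}[\rho(\log\rho-\log\sigma)]$ if $\operatorname{supp}\rho\subseteq\operatorname{supp}\sigma$ and $D(\rho\|\sigma)=+\infty$ otherwise. Let $\mathcal A_{A\to B}$ be a quantum channel satisfying $\varepsilon$-QLDP, let $X\sim P_X$ be a random variable with values in a finite alphabet $\mathcal X$, let $(\rho^x)_{x\in\mathcal X}$ be states on $\mathcal H_A$, and put $$\sigma_{XB} := \sum_{x\in\mathcal X}P_X(x)\,|x\rangle\langle x|\otimes\mathcal A(\rho^x).$$ Then the Holevo information $I(X;B)_\sigma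 := D(\sigma_{XB}\,\|\,\sigma_X\otimes\sigma_B)$, where $\sigma_X=\operatorname{Tr}_B[\sigma_{XB}]$ and $\sigma_B=\operatorname{Tr}_X[\sigma_{XB}]$, satisfies $$I(X;B)_\sigma \;\le\; \varepsilon\,\frac{e^{\varepsilon}-1}{e^{\varepsilon}+1}.$$ Moreover, for every $\varepsilon\ge 0$, $$\varepsilon\,\frac{e^{\varepsilon}-1}{e^{\varepsilon}+1}\;\le\;\min\{\varepsilon,\ \varepsilon^2/2\}.$$ -/

import Mathlib

open scoped Kronecker ComplexOrder

noncomputable section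

namespace QInfo

/-- The support of an operator on the Hilbert space `ℂⁿ`: the orthogonal complement of its kernel. -/
def supp {n : Type*} [Fintype n] [DecidableEq n] (M : Matrix n n ℂ) :
    Submodule ℂ (EuclideanSpace ℂ n) :=
  (LinearMap.ker (Matrix.toEuclideanLin M))ᗮ

/-- A quantum state: a positive semidefinite operator of unit trace. -/
def IsState {n : Type*} [Fintype n] (ρ : Matrix n n ℂ) : Prop :=
  ρ.PosSemidef ∧ ρ.trace = 1

/-- The ampliation `id_k ⊗ Φ`, which applies `Φ` to every block of a `k × k` block matrix. -/
def ampliation {A B : Type*} (k : ℕ) (Φ : Matrix A A ℂ →ₗ[ℂ] Matrix B B ℂ)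
    (M : Matrix (Fin k × A) (Fin k × A) ℂ) : Matrix (Fin k × B) (Fin k × B) ℂ :=
  Matrix.of fun p q => Φ (Matrix.of fun i j => M (p.1, i) (q.1, j)) p.2 q.2

/-- Complete positivity: every ampliation `id_k ⊗ Φ` preserves positive semidefiniteness. -/
def IsCompletelyPositive {A B : Type*} [Fintype A] [Fintype B]
    (Φ : Matrix A A ℂ →ₗ[ℂ] Matrix B B ℂ) : Prop :=
  ∀ (k : ℕ) (M : Matrix (Fin k × A) (Fin k × A) ℂ), M.PosSemidef → (ampliation k Φ M).PosSemidef

/-- A quantum channel: a completely positive and trace-preserving linear map. -/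
def IsChannel {A B : Type*} [Fintype A] [Fintype B]
    (Φ : Matrix A A ℂ →ₗ[ℂ] Matrix B B ℂ) : Prop :=
  IsCompletelyPositive Φ ∧ ∀ M : Matrix A A ℂ, (Φ M).trace = M.trace

/-- `(ε, δ)`-quantum local differential privacy:
`Tr[M 𝒜(ρ)] ≤ e^ε Tr[M 𝒜(σ)] + δ` for all states `ρ`, `σ` and all `0 ≤ M ≤ I`. -/
def IsQLDP {A B : Type*} [Fintype A] [Fintype B] [DecidableEq B] (ε δ : ℝ)
    (𝒜 : Matrix A A ℂ →ₗ[ℂ] Matrix B B ℂ) : Prop :=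
  ∀ ρ σ : Matrix A A ℂ, IsState ρ → IsState σ →
    ∀ M : Matrix B B ℂ, M.PosSemidef → (1 - M).PosSemidef →
      (M * 𝒜 ρ).trace.re ≤ Real.exp ε * (M * 𝒜 σ).trace.re + δ

open Classical in
/-- The quantum (Umegaki) relative entropy, with the natural logarithm. As `Real.log 0 = 0`, the
matrix logarithm `cfc Real.log` vanishes on the kernel, which is the usual convention. -/
def relativeEntropy {n : Type*} [Fintype n] [DecidableEq n] (ρ σ : Matrix n n ℂ) : EReal :=
  if supp ρ ≤ supp σ then
    (((ρ * (cfc Real.log ρ - cfc Real.log σ)).trace.re : ℝ) : EReal)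
  else ⊤

/-- The partial trace over the second factor. -/
def traceSnd {X B : Type*} [Fintype B] (τ : Matrix (X × B) (X × B) ℂ) : Matrix X X ℂ :=
  Matrix.of fun x y => ∑ b, τ (x, b) (y, b)

/-- The partial trace over the first factor. -/
def traceFst {X B : Type*} [Fintype X] (τ : Matrix (X × B) (X × B) ℂ) : Matrix B B ℂ :=
  Matrix.of fun b c => ∑ x, τ (x, b) (x, c)

/-- The mutual information `I(X;B)_τ = D(τ_{XB} ‖ τ_X ⊗ τ_B)` of a bipartite operator; for a
classical-quantum state it is the Holevo information. -/
def holevoInformation {X B : Type*} [Fintype X] [DecidableEq X] [Fintype B] [DecidableEq B]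
    (τ : Matrix (X × B) (X × B) ℂ) : EReal :=
  relativeEntropy τ (traceSnd τ ⊗ₖ traceFst τ)

/-- The classical-quantum state `∑ₓ P(x) |x⟩⟨x| ⊗ ωₓ`. -/
def cqState {X B : Type*} [Fintype X] [DecidableEq X] (P : X → ℝ) (ω : X → Matrix B B ℂ) :
    Matrix (X × B) (X × B) ℂ :=
  ∑ x, (P x : ℂ) • (Matrix.single x x (1 : ℂ) ⊗ₖ ω x)

end QInfo

end

/-! Testing privacy on rank-one projections gives `𝒜 ρ ≤ e^ε 𝒜 σ` (`le_exp_smul_of_isQLDP`).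
Averaging over `P` blockwise, `σ_XB` and `σ_X ⊗ σ_B` dominate each other up to the factor `e^ε`.

For two such states `ρ`, `σ`, put `Δ = log ρ - log σ`. Operator monotonicity of the logarithm gives
`-ε ≤ Δ ≤ ε`. Golden–Thompson (`re_trace_exp_add_le`) gives `1 = Tr σ ≤ Tr ρ e^{-Δ}`, and the chord
of `exp` over `[-ε, ε]` bounds `ε e^{-Δ}` by `ε cosh ε - sinh ε • Δ`. Hence `sinh ε · Tr ρΔ ≤ ε
(cosh ε - 1)`, i.e. `D(ρ‖σ) ≤ ε tanh (ε/2)`. Singular states are handled by adding their common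
kernel projection. -/

namespace QInfo

open Matrix Filter Topology

/-! ### Trace inequalities for powers of matrix products -/

section TraceInequalities

variable {n : Type*} [Fintype n]

lemma re_trace_mul_conjTranspose_self_nonneg (M : Matrix n n ℂ) : 0 ≤ (M * Mᴴ).trace.re :=
  (Complex.le_def.mp (posSemidef_self_mul_conjTranspose M).trace_nonneg).1

lemma re_trace_mul_le (M N : Matrix n n ℂ) :
    2 * (M * Nᴴ).trace.re ≤ (M * Mᴴ).trace.re + (N * Nᴴ).trace.re := by
  have h := re_trace_mul_conjTranspose_self_nonneg (M - N)
  have h' : (N * Mᴴ).trace.re = (M * Nᴴ).trace.re := by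
    rw [← Complex.conj_re, starRingEnd_apply, ← trace_conjTranspose, conjTranspose_mul,
      conjTranspose_conjTranspose]
  simp only [conjTranspose_sub, sub_mul, mul_sub, trace_sub, Complex.sub_re] at h
  linarith

variable [DecidableEq n]

lemma trace_mul_pow_comm (M N : Matrix n n ℂ) (k : ℕ) :
    ((M * N) ^ k).trace = ((N * M) ^ k).trace := by
  cases k with
  | zero => simp
  | succ k =>
    rw [pow_succ', mul_assoc, ← mul_pow_mul, trace_mul_comm, mul_assoc, ← pow_succ]

/-- Trace inequalities behind the Golden–Thompson inequality, proved by a joint induction. -/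
lemma re_trace_pow_two_pow_le (k : ℕ) :
    (∀ M : Matrix n n ℂ, (M ^ 2 ^ (k + 1)).trace.re ≤ ((M * Mᴴ) ^ 2 ^ k).trace.re) ∧
    ∀ P Q : Matrix n n ℂ, P.IsHermitian → Q.IsHermitian →
      ((P * Q) ^ 2 ^ k).trace.re ≤ (P ^ 2 ^ k * Q ^ 2 ^ k).trace.re := by
  induction k with
  | zero =>
    refine ⟨fun M => ?_, fun P Q _ _ => by simp⟩
    have h := re_trace_mul_le M Mᴴ
    rw [conjTranspose_conjTranspose, trace_mul_comm Mᴴ M] at h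
    simpa [sq] using (by linarith : (M * M).trace.re ≤ (M * Mᴴ).trace.re)
  | succ k ih =>
    obtain ⟨ihT, ihG⟩ := ih
    constructor
    · intro M
      have hP : (Mᴴ * M).IsHermitian := isHermitian_conjTranspose_mul_self M
      have hQ : (M * Mᴴ).IsHermitian := isHermitian_mul_conjTranspose_self M
      have h1 := ihT (M ^ 2)
      have h2 : ((M ^ 2 * (M ^ 2)ᴴ) ^ 2 ^ k).trace = (((Mᴴ * M) * (M * Mᴴ)) ^ 2 ^ k).trace := by
        have e : M ^ 2 * (M ^ 2)ᴴ = M * (M * Mᴴ * Mᴴ) := by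
          simp only [sq, conjTranspose_mul, mul_assoc]
        rw [e, trace_mul_pow_comm, mul_assoc (M * Mᴴ), trace_mul_pow_comm]
      have h3 := ihG _ _ hP hQ
      -- By cyclicity both squares on the right have the same trace, so the bound closes with
      -- constant one.
      have h4 := re_trace_mul_le ((Mᴴ * M) ^ 2 ^ k) ((M * Mᴴ) ^ 2 ^ k)
      rw [(hP.pow _).eq, (hQ.pow _).eq, ← pow_add, ← pow_add, ← two_mul, ← pow_succ',
        trace_mul_pow_comm Mᴴ M] at h4
      rw [h2, ← pow_mul, ← pow_succ'] at h1
      linarith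
    · intro P Q hP hQ
      have h1 := ihT (P * Q)
      have e : P * Q * (P * Q)ᴴ = P * (Q ^ 2 * P) := by
        rw [conjTranspose_mul, hP.eq, hQ.eq, sq]; simp only [mul_assoc]
      have h2 := ihG (Q ^ 2) (P ^ 2) (hQ.pow 2) (hP.pow 2)
      rw [e, trace_mul_pow_comm P (Q ^ 2 * P), mul_assoc, ← sq] at h1
      rw [← pow_mul, ← pow_mul, ← pow_succ', trace_mul_comm] at h2
      exact h1.trans h2

end TraceInequalities

/-! ### Lie–Trotter product formula -/

section Trotter

variable {𝔸 : Type*} [NormedRing 𝔸]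

lemma norm_pow_sub_pow_le [NormOneClass 𝔸] {x y : 𝔸} {K : ℝ} (hx : ‖x‖ ≤ K) (hy : ‖y‖ ≤ K)
    (hK : 1 ≤ K) (n : ℕ) : ‖x ^ n - y ^ n‖ ≤ n * K ^ n * ‖x - y‖ := by
  induction n with
  | zero => simp
  | succ n ih =>
    have e : x ^ (n + 1) - y ^ (n + 1) = x ^ n * (x - y) + (x ^ n - y ^ n) * y := by
      rw [pow_succ, pow_succ]; noncomm_ring
    have h1 : ‖x ^ n‖ ≤ K ^ n := (norm_pow_le x n).trans (by gcongr)
    calc ‖x ^ (n + 1) - y ^ (n + 1)‖ ≤ ‖x ^ n‖ * ‖x - y‖ + ‖x ^ n - y ^ n‖ * ‖y‖ := by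
          rw [e]
          exact (norm_add_le _ _).trans (add_le_add (norm_mul_le _ _) (norm_mul_le _ _))
      _ ≤ K ^ n * ‖x - y‖ + n * K ^ n * ‖x - y‖ * K := by gcongr
      _ ≤ K ^ (n + 1) * ‖x - y‖ + n * K ^ n * ‖x - y‖ * K := by
          gcongr
          exact n.le_succ
      _ = (n + 1 : ℕ) * K ^ (n + 1) * ‖x - y‖ := by push_cast; ring

variable [NormedAlgebra ℝ 𝔸]

lemma norm_exp_le [NormOneClass 𝔸] [CompleteSpace 𝔸] (x : 𝔸) : ‖NormedSpace.exp x‖ ≤ Real.exp ‖x‖ := by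
  have hs := NormedSpace.norm_expSeries_summable' (𝕂 := ℝ) x
  rw [NormedSpace.exp_eq_tsum ℝ, Real.exp_eq_exp_ℝ, NormedSpace.exp_eq_tsum ℝ]
  refine (norm_tsum_le_tsum_norm hs).trans
    (hs.tsum_le_tsum (fun k => ?_) (NormedSpace.expSeries_summable' (𝕂 := ℝ) ‖x‖))
  rw [norm_smul, smul_eq_mul, Real.norm_of_nonneg (by positivity)]
  gcongr
  exact norm_pow_le x k

/-- The Lie–Trotter product formula. -/
lemma tendsto_exp_mul_exp_pow [NormOneClass 𝔸] [CompleteSpace 𝔸] (a b : 𝔸) :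
    Tendsto (fun n : ℕ => (NormedSpace.exp ((n : ℝ)⁻¹ • a) * NormedSpace.exp ((n : ℝ)⁻¹ • b)) ^ n)
      atTop (𝓝 (NormedSpace.exp (a + b))) := by
  -- First-order agreement at `0` makes `n ‖x - y‖` tend to `0`, which beats the factor `n` from
  -- telescoping.
  have hd : HasDerivAt (fun t : ℝ => NormedSpace.exp (t • a) * NormedSpace.exp (t • b)
      - NormedSpace.exp (t • (a + b))) 0 0 := by
    have h := ((hasDerivAt_exp_smul_const (𝕂 := ℝ) a (0 : ℝ)).mul
      (hasDerivAt_exp_smul_const (𝕂 := ℝ) b (0 : ℝ))).sub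
      (hasDerivAt_exp_smul_const (𝕂 := ℝ) (a + b) (0 : ℝ))
    convert! h using 1
    simp
  have hn : Tendsto (fun n : ℕ => (n : ℝ)⁻¹) atTop (𝓝[≠] 0) :=
    tendsto_nhdsWithin_iff.mpr ⟨tendsto_inv_atTop_nhds_zero_nat,
      (eventually_gt_atTop 0).mono fun n hn => by simp; omega⟩
  have h0 := (hasDerivAt_iff_tendsto_slope_zero.mp hd).comp hn
  have h1 := (h0.norm.const_mul (Real.exp (‖a‖ + ‖b‖)))
  simp only [norm_zero, mul_zero] at h1
  refine tendsto_iff_norm_sub_tendsto_zero.mpr (squeeze_zero' (.of_forall fun _ => norm_nonneg _)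
    ?_ h1)
  filter_upwards [eventually_gt_atTop 0] with n hn0
  have hn0' : (0 : ℝ) < n := by exact_mod_cast hn0
  set x := NormedSpace.exp ((n : ℝ)⁻¹ • a) * NormedSpace.exp ((n : ℝ)⁻¹ • b) with hx
  set y := NormedSpace.exp ((n : ℝ)⁻¹ • (a + b)) with hy
  have hnorm (c : 𝔸) : ‖(n : ℝ)⁻¹ • c‖ = (n : ℝ)⁻¹ * ‖c‖ := by
    rw [norm_smul, Real.norm_of_nonneg (by positivity)]
  set K := Real.exp ((n : ℝ)⁻¹ * (‖a‖ + ‖b‖)) with hK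
  have hxK : ‖x‖ ≤ K := by
    rw [hK, mul_add, Real.exp_add, ← hnorm, ← hnorm]
    exact (norm_mul_le _ _).trans (by gcongr <;> exact norm_exp_le _)
  have hyK : ‖y‖ ≤ K := by
    refine (norm_exp_le _).trans (Real.exp_le_exp.mpr ?_)
    rw [hnorm]
    gcongr
    exact norm_add_le _ _
  have hKn : K ^ n = Real.exp (‖a‖ + ‖b‖) := by
    rw [hK, ← Real.exp_nat_mul, mul_inv_cancel_left₀ hn0'.ne']
  have hyn : y ^ n = NormedSpace.exp (a + b) := by
    let _ : NormedAlgebra ℚ 𝔸 := .restrictScalars ℚ ℝ 𝔸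
    rw [hy, ← NormedSpace.exp_nsmul, ← Nat.cast_smul_eq_nsmul ℝ, smul_smul,
      mul_inv_cancel₀ hn0'.ne', one_smul]
  have h := norm_pow_sub_pow_le hxK hyK (Real.one_le_exp (by positivity)) n
  rw [hyn, hKn] at h
  refine h.trans (le_of_eq ?_)
  simp only [Function.comp_apply, zero_add, zero_smul, NormedSpace.exp_zero, mul_one, sub_self,
    sub_zero, inv_inv, norm_smul, Real.norm_natCast, ← hx, ← hy]
  ring

end Trotter

/-! ### Golden–Thompson inequality -/

section GoldenThompson

open scoped Matrix.Norms.L2Operator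

variable {n : Type*} [Fintype n] [DecidableEq n]

/-- The Golden–Thompson inequality. -/
theorem re_trace_exp_add_le {H K : Matrix n n ℂ} (hH : H.IsHermitian) (hK : K.IsHermitian) :
    (NormedSpace.exp (H + K)).trace.re ≤ (NormedSpace.exp H * NormedSpace.exp K).trace.re := by
  rcases isEmpty_or_nonempty n with h | h
  · simp [trace]
  have : NormOneClass (Matrix n n ℂ) := inferInstance
  have h1 := (tendsto_exp_mul_exp_pow H K).comp (tendsto_pow_atTop_atTop_of_one_lt one_lt_two)
  have hc : Continuous fun M : Matrix n n ℂ => M.trace.re :=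
    Complex.continuous_re.comp continuous_id.matrix_trace
  refine le_of_tendsto ((hc.tendsto _).comp h1) (.of_forall fun k => ?_)
  have hpow (M : Matrix n n ℂ) :
      NormedSpace.exp (((2 ^ k : ℕ) : ℝ)⁻¹ • M) ^ 2 ^ k = NormedSpace.exp M := by
    let _ : NormedAlgebra ℚ (Matrix n n ℂ) := .restrictScalars ℚ ℝ _
    rw [← NormedSpace.exp_nsmul, ← Nat.cast_smul_eq_nsmul ℝ, smul_smul,
      mul_inv_cancel₀ (by positivity), one_smul]
  have hherm {M : Matrix n n ℂ} (hM : M.IsHermitian) :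
      (NormedSpace.exp (((2 ^ k : ℕ) : ℝ)⁻¹ • M)).IsHermitian :=
    IsHermitian.exp (by
      rw [IsHermitian, conjTranspose_smul, hM.eq, star_trivial])
  have h2 := (re_trace_pow_two_pow_le k).2 _ _ (hherm hH) (hherm hK)
  rwa [hpow, hpow] at h2

end GoldenThompson

/-! ### Relative entropy of mutually dominated states -/

section RelativeEntropy

open scoped Matrix.Norms.L2Operator MatrixOrder

variable {n : Type*} [Fintype n]

lemma mulVec_eq_zero_of_le {ρ σ : Matrix n n ℂ} (hσ : σ.PosSemidef) {c : ℝ} (h : σ ≤ c • ρ)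
    {v : n → ℂ} (hv : ρ *ᵥ v = 0) : σ *ᵥ v = 0 := by
  have h1 := (le_iff.mp h).dotProduct_mulVec_nonneg v
  rw [sub_mulVec, smul_mulVec, hv, smul_zero, zero_sub, dotProduct_neg] at h1
  exact (hσ.dotProduct_mulVec_zero_iff v).mp
    (le_antisymm (neg_nonneg.mp h1) (hσ.dotProduct_mulVec_nonneg v))

lemma mul_eq_zero_of_le {ρ σ Y : Matrix n n ℂ} (hσ : σ.PosSemidef) {c : ℝ} (h : σ ≤ c • ρ)
    (hY : ρ * Y = 0) : σ * Y = 0 := by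
  classical
  refine ext_of_mulVec_single fun i => ?_
  rw [← mulVec_mulVec, zero_mulVec]
  refine mulVec_eq_zero_of_le hσ h ?_
  rw [mulVec_mulVec, hY, zero_mulVec]

lemma re_trace_mul_le_re_trace_mul {ρ H K : Matrix n n ℂ} (hρ : ρ.PosSemidef) (h : H ≤ K) :
    (ρ * H).trace.re ≤ (ρ * K).trace.re := by
  classical
  obtain ⟨S, rfl⟩ := CStarAlgebra.nonneg_iff_eq_star_mul_self.mp hρ.nonneg
  have h1 := ((le_iff.mp h).mul_mul_conjTranspose_same S).trace_nonneg
  rw [mul_assoc, trace_mul_comm, mul_assoc, trace_mul_comm, ← star_eq_conjTranspose, mul_sub,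
    trace_sub] at h1
  simpa using (Complex.le_def.mp h1).1

variable [DecidableEq n]

lemma continuousOn_spectrum (f : ℝ → ℝ) (M : Matrix n n ℂ) : ContinuousOn f (spectrum ℝ M) :=
  M.finite_real_spectrum.continuousOn f

/-- The orthogonal projection onto the kernel of a Hermitian matrix. -/
noncomputable def kernelProj (ρ : Matrix n n ℂ) : Matrix n n ℂ :=
  cfc (fun x : ℝ => if x = 0 then 1 else 0) ρ

lemma isHermitian_kernelProj (ρ : Matrix n n ℂ) : (kernelProj ρ).IsHermitian :=
  cfc_predicate _ ρ

lemma cfc_mul_kernelProj (ρ : Matrix n n ℂ) {f : ℝ → ℝ} (hf : f 0 = 0) :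
    cfc f ρ * kernelProj ρ = 0 := by
  rw [kernelProj, ← cfc_mul _ _ ρ (continuousOn_spectrum _ _) (continuousOn_spectrum _ _)]
  rw [← cfc_zero ℝ ρ]
  congr 1
  ext x
  by_cases hx : x = 0 <;> simp [hx, hf]

lemma mul_kernelProj {ρ : Matrix n n ℂ} (hρ : ρ.IsHermitian) : ρ * kernelProj ρ = 0 := by
  have h := cfc_mul_kernelProj ρ (f := id) rfl
  rwa [cfc_id ℝ ρ hρ.isSelfAdjoint] at h

lemma kernelProj_mul_of_mul_eq_zero {ρ Y : Matrix n n ℂ} (hρ : ρ.IsHermitian) (hY : ρ * Y = 0) :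
    kernelProj ρ * Y = Y := by
  -- Since `0⁻¹ = 0`, the functional calculus of the inverse is the pseudoinverse.
  have h : kernelProj ρ = 1 - cfc (fun x : ℝ => x⁻¹) ρ * ρ := by
    nth_rw 3 [← cfc_id ℝ ρ hρ.isSelfAdjoint]
    rw [← cfc_mul _ _ ρ (continuousOn_spectrum _ _) (continuousOn_spectrum _ _),
      ← cfc_one ℝ ρ, ← cfc_sub _ _ ρ (continuousOn_spectrum _ _) (continuousOn_spectrum _ _),
      kernelProj]
    congr 1
    ext x
    by_cases hx : x = 0 <;> simp [hx]
  rw [h, sub_mul, one_mul, mul_assoc, hY, mul_zero, sub_zero]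

lemma kernelProj_eq {ρ σ : Matrix n n ℂ} (hρ : ρ.PosSemidef) (hσ : σ.PosSemidef) {c : ℝ}
    (h : σ ≤ c • ρ) (h' : ρ ≤ c • σ) : kernelProj ρ = kernelProj σ := by
  have h1 := kernelProj_mul_of_mul_eq_zero hσ.1 (mul_eq_zero_of_le hσ h (mul_kernelProj hρ.1))
  have h2 := kernelProj_mul_of_mul_eq_zero hρ.1 (mul_eq_zero_of_le hρ h' (mul_kernelProj hσ.1))
  have h3 := congrArg conjTranspose h2
  rw [conjTranspose_mul, (isHermitian_kernelProj ρ).eq, (isHermitian_kernelProj σ).eq] at h3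
  exact h1.symm.trans h3

lemma add_kernelProj_eq_cfc {ρ : Matrix n n ℂ} (hρ : ρ.IsHermitian) :
    ρ + kernelProj ρ = cfc (fun x : ℝ => if x = 0 then 1 else x) ρ := by
  nth_rw 1 [← cfc_id ℝ ρ hρ.isSelfAdjoint]
  rw [kernelProj, ← cfc_add _ _ _ (continuousOn_spectrum _ _) (continuousOn_spectrum _ _)]
  congr 1
  ext x
  by_cases hx : x = 0 <;> simp [hx]

lemma isStrictlyPositive_add_kernelProj {ρ : Matrix n n ℂ} (hρ : ρ.PosSemidef) :
    IsStrictlyPositive (ρ + kernelProj ρ) := by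
  refine (add_kernelProj_eq_cfc hρ.1).symm ▸
    (cfc_isStrictlyPositive_iff _ _ (continuousOn_spectrum _ _) hρ.1.isSelfAdjoint).mpr ?_
  intro x hx
  have := spectrum_nonneg_of_nonneg hρ.nonneg hx
  split_ifs with h
  · exact one_pos
  · exact lt_of_le_of_ne this (Ne.symm h)

/-- Eigenvalue `0` is replaced by `1`, and `Real.log 0 = 0 = Real.log 1`. -/
lemma log_add_kernelProj {ρ : Matrix n n ℂ} (hρ : ρ.IsHermitian) :
    CFC.log (ρ + kernelProj ρ) = cfc Real.log ρ := by
  rw [add_kernelProj_eq_cfc hρ, CFC.log, ← cfc_comp' Real.log _ ρ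
    ((ρ.finite_real_spectrum.image _).continuousOn _) (continuousOn_spectrum _ _) hρ.isSelfAdjoint]
  congr 1
  ext x
  by_cases hx : x = 0 <;> simp [hx]

lemma exp_mul_eq_self_of_mul_eq_zero {M Y : Matrix n n ℂ} (h : M * Y = 0) :
    NormedSpace.exp M * Y = Y := by
  rw [NormedSpace.exp_eq_tsum ℝ, ← Summable.tsum_mul_right _
    (NormedSpace.expSeries_summable' (𝕂 := ℝ) M), tsum_eq_single 0]
  · simp
  · intro k hk
    obtain ⟨k, rfl⟩ := Nat.exists_eq_succ_of_ne_zero hk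
    rw [smul_mul_assoc, pow_succ, mul_assoc, h, mul_zero, smul_zero]

/-- Convexity: `exp` lies below its chord over `[-ε, ε]`. The factor `ε` clears the slope `sinh ε /
ε`. -/
lemma mul_exp_neg_le {ε x : ℝ} (h1 : -ε ≤ x) (h2 : x ≤ ε) :
    ε * Real.exp (-x) ≤ ε * Real.cosh ε - Real.sinh ε * x := by
  rcases (by linarith : 0 ≤ ε).eq_or_lt with rfl | hε
  · simp
  have ha : 0 ≤ (ε - x) / (2 * ε) := div_nonneg (by linarith) (by linarith)
  have hb : 0 ≤ (ε + x) / (2 * ε) := div_nonneg (by linarith) (by linarith)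
  have h := convexOn_exp.2 (Set.mem_univ ε) (Set.mem_univ (-ε)) ha hb (by field_simp; ring)
  have e : ((ε - x) / (2 * ε)) • ε + ((ε + x) / (2 * ε)) • (-ε) = -x := by
    simp only [smul_eq_mul]; field_simp; ring
  rw [e] at h
  refine (mul_le_mul_of_nonneg_left h hε.le).trans (le_of_eq ?_)
  rw [Real.cosh_eq, Real.sinh_eq]
  simp only [smul_eq_mul]
  field_simp
  ring

lemma smul_exp_neg_le {ε : ℝ} {Δ : Matrix n n ℂ} (hΔ : Δ.IsHermitian)
    (h1 : algebraMap ℝ (Matrix n n ℂ) (-ε) ≤ Δ) (h2 : Δ ≤ algebraMap ℝ (Matrix n n ℂ) ε) :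
    ε • NormedSpace.exp (-Δ) ≤ algebraMap ℝ _ (ε * Real.cosh ε) - Real.sinh ε • Δ := by
  have hl := (algebraMap_le_iff_le_spectrum (p := IsSelfAdjoint) (a := Δ) (ha := hΔ)).mp h1
  have hu := (le_algebraMap_iff_spectrum_le (p := IsSelfAdjoint) (a := Δ) (ha := hΔ)).mp h2
  have e1 : ε • NormedSpace.exp (-Δ) = cfc (fun x => ε * Real.exp (-x)) Δ := by
    rw [← CFC.real_exp_eq_normedSpace_exp hΔ.neg, cfc_const_mul ε _ Δ (continuousOn_spectrum _ _),
      ← cfc_comp_neg Real.exp Δ (by fun_prop) hΔ.isSelfAdjoint]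
  have e2 : algebraMap ℝ _ (ε * Real.cosh ε) - Real.sinh ε • Δ
      = cfc (fun x => ε * Real.cosh ε - Real.sinh ε * x) Δ := by
    rw [cfc_sub _ _ Δ (continuousOn_spectrum _ _) (continuousOn_spectrum _ _),
      cfc_const _ Δ hΔ.isSelfAdjoint, cfc_const_mul _ (fun x => x) Δ, cfc_id' ℝ Δ hΔ.isSelfAdjoint]
  rw [e1, e2]
  exact cfc_mono (fun x hx => mul_exp_neg_le (hl x hx) (hu x hx)) (continuousOn_spectrum _ _)
    (continuousOn_spectrum _ _)

lemma log_sub_log_le {ρ σ : Matrix n n ℂ} {ε : ℝ} (hρ : IsStrictlyPositive ρ)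
    (hσ : IsStrictlyPositive σ) (h : ρ ≤ Real.exp ε • σ) :
    CFC.log ρ - CFC.log σ ≤ algebraMap ℝ _ ε := by
  have h1 := CFC.log_le_log h hρ
  rw [CFC.log_smul' σ (Real.exp_pos ε) hσ, Real.log_exp] at h1
  exact sub_le_iff_le_add.mpr h1

/-- If `ρ` and `σ` are states with `e^{-ε} σ ≤ ρ ≤ e^ε σ`, then
`D(ρ‖σ) ≤ ε (cosh ε - 1) / sinh ε`. -/
theorem sinh_mul_re_trace_le {ρ σ : Matrix n n ℂ} (hρ : IsState ρ) (hσ : IsState σ) {ε : ℝ}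
    (h1 : ρ ≤ Real.exp ε • σ) (h2 : σ ≤ Real.exp ε • ρ) (hε : 0 ≤ ε) :
    Real.sinh ε * (ρ * (cfc Real.log ρ - cfc Real.log σ)).trace.re
      ≤ ε * (Real.cosh ε - 1) := by
  set Q := kernelProj ρ with hQ
  have hQσ : Q = kernelProj σ := kernelProj_eq hρ.1 hσ.1 h2 h1
  have hQ0 : 0 ≤ Q := cfc_nonneg fun x _ => by positivity
  have hQe : Q ≤ Real.exp ε • Q := by
    rw [← sub_nonneg, ← one_smul ℝ Q, smul_smul, mul_one, ← sub_smul]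
    exact smul_nonneg (sub_nonneg.mpr (Real.one_le_exp hε)) hQ0
  have hρ' : IsStrictlyPositive (ρ + Q) := isStrictlyPositive_add_kernelProj hρ.1
  have hσ' : IsStrictlyPositive (σ + Q) := hQσ ▸ isStrictlyPositive_add_kernelProj hσ.1
  have hlρ : CFC.log (ρ + Q) = cfc Real.log ρ := log_add_kernelProj hρ.1.1
  have hlσ : CFC.log (σ + Q) = cfc Real.log σ := hQσ ▸ log_add_kernelProj hσ.1.1
  set Δ := cfc Real.log ρ - cfc Real.log σ with hΔ
  have hΔH : Δ.IsHermitian := IsHermitian.sub (cfc_predicate _ _) (cfc_predicate _ _)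
  have hΔu : Δ ≤ algebraMap ℝ _ ε := by
    rw [hΔ, ← hlρ, ← hlσ]
    exact log_sub_log_le hρ' hσ' (by rw [smul_add]; exact add_le_add h1 hQe)
  have hΔl : algebraMap ℝ _ (-ε) ≤ Δ := by
    rw [hΔ, ← hlρ, ← hlσ, map_neg, neg_le, neg_sub]
    exact log_sub_log_le hσ' hρ' (by rw [smul_add]; exact add_le_add h2 hQe)
  have hΔQ : -Δ * Q = 0 := by
    rw [neg_mul, hΔ, sub_mul, cfc_mul_kernelProj ρ Real.log_zero, hQσ,
      cfc_mul_kernelProj σ Real.log_zero, sub_zero, neg_zero]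
  -- The exponents add up to `log (σ + Q)`. As `e^{-Δ}` fixes `Q`, the term `Tr Q` appears on both
  -- sides and cancels.
  have hGT := re_trace_exp_add_le (H := CFC.log (ρ + Q)) IsSelfAdjoint.log hΔH.neg
  rw [CFC.exp_log _ hρ', hlρ, hΔ, neg_sub, add_sub_cancel, ← hlσ, CFC.exp_log _ hσ', hlσ,
    ← neg_sub, ← hΔ, add_mul, trace_add, trace_add, trace_mul_comm Q,
    exp_mul_eq_self_of_mul_eq_zero hΔQ, hσ.2] at hGT
  have hch := re_trace_mul_le_re_trace_mul hρ.1 (smul_exp_neg_le hΔH hΔl hΔu)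
  rw [Algebra.algebraMap_eq_smul_one, mul_sub, mul_smul_comm, mul_smul_comm, mul_smul_comm,
    mul_one, trace_sub, trace_smul, trace_smul, trace_smul, hρ.2] at hch
  simp only [Complex.add_re, Complex.one_re, Complex.sub_re, Complex.smul_re, smul_eq_mul,
    mul_one] at hGT hch
  nlinarith

lemma supp_le_of_le {ρ σ : Matrix n n ℂ} (hρ : ρ.PosSemidef) {c : ℝ} (h : ρ ≤ c • σ) :
    supp ρ ≤ supp σ := by
  refine Submodule.orthogonal_le fun v hv => ?_
  rw [LinearMap.mem_ker] at hv ⊢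
  have hv' : σ *ᵥ v.ofLp = 0 := by simpa [toLpLin_apply] using hv
  simpa [toLpLin_apply] using mulVec_eq_zero_of_le hρ h hv'

lemma mul_exp_sub_one_div_eq {ε : ℝ} (hε : 0 < ε) :
    ε * (Real.cosh ε - 1) = Real.sinh ε * (ε * ((Real.exp ε - 1) / (Real.exp ε + 1))) := by
  have := Real.exp_pos ε
  rw [Real.cosh_eq, Real.sinh_eq, Real.exp_neg]
  field_simp
  ring

theorem relativeEntropy_le {ρ σ : Matrix n n ℂ} (hρ : IsState ρ) (hσ : IsState σ) {ε : ℝ}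
    (hε : 0 ≤ ε) (h1 : ρ ≤ Real.exp ε • σ) (h2 : σ ≤ Real.exp ε • ρ) :
    relativeEntropy ρ σ ≤ ((ε * ((Real.exp ε - 1) / (Real.exp ε + 1)) : ℝ) : EReal) := by
  rw [relativeEntropy, if_pos (supp_le_of_le hρ.1 h1), EReal.coe_le_coe_iff]
  -- At `ε = 0` the factor `sinh ε` cannot be cancelled, but then `ρ = σ`.
  rcases hε.eq_or_lt with rfl | hε'
  · rw [Real.exp_zero, one_smul] at h1 h2
    simp [le_antisymm h1 h2]
  · have h := sinh_mul_re_trace_le hρ hσ h1 h2 hε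
    rw [mul_exp_sub_one_div_eq hε'] at h
    exact le_of_mul_le_mul_left h (Real.sinh_pos_iff.mpr hε')

end RelativeEntropy

/-! ### From privacy to operator inequalities -/

section Privacy

open scoped MatrixOrder

variable {A B : Type*} [Fintype A] [Fintype B]

lemma IsCompletelyPositive.posSemidef_apply {Φ : Matrix A A ℂ →ₗ[ℂ] Matrix B B ℂ}
    (hΦ : IsCompletelyPositive Φ) {M : Matrix A A ℂ} (hM : M.PosSemidef) : (Φ M).PosSemidef := by
  have h := hΦ 1 (M.submatrix Prod.snd Prod.snd) (hM.submatrix Prod.snd)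
  exact h.submatrix fun b => (0, b)

lemma IsChannel.isState_apply {Φ : Matrix A A ℂ →ₗ[ℂ] Matrix B B ℂ} (hΦ : IsChannel Φ)
    {ρ : Matrix A A ℂ} (hρ : IsState ρ) : IsState (Φ ρ) :=
  ⟨hΦ.1.posSemidef_apply hρ.1, (hΦ.2 ρ).trans hρ.2⟩

lemma le_exp_smul_of_isQLDP [DecidableEq B] {ε : ℝ} {Φ : Matrix A A ℂ →ₗ[ℂ] Matrix B B ℂ}
    (hΦ : IsChannel Φ) (hε : IsQLDP ε 0 Φ) {ρ σ : Matrix A A ℂ} (hρ : IsState ρ)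
    (hσ : IsState σ) : Φ ρ ≤ Real.exp ε • Φ σ := by
  have hρ' := (hΦ.isState_apply hρ).1
  have hσ' := (hΦ.isState_apply hσ).1.nonneg
  have hH : (Real.exp ε • Φ σ - Φ ρ).IsHermitian :=
    (smul_nonneg (Real.exp_pos ε).le hσ').posSemidef.1.sub hρ'.1
  refine le_iff.mpr (.of_dotProduct_mulVec_nonneg hH fun v => ?_)
  rcases eq_or_ne v 0 with rfl | hv
  · simp
  have hpos : 0 < star v ⬝ᵥ v := dotProduct_star_self_pos_iff.mpr hv
  obtain ⟨r, hr⟩ : ∃ r : ℝ, star v ⬝ᵥ v = r :=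
    ⟨_, (Complex.conj_eq_iff_re.mp (by simpa using (IsSelfAdjoint.of_nonneg hpos.le).star_eq)).symm⟩
  have hr0 : 0 < r := by rw [hr] at hpos; exact_mod_cast hpos
  -- The test operator is `r⁻¹ • M`, the projection onto the line of `v`.
  set M : Matrix B B ℂ := vecMulVec v (star v) with hM
  have hMp : M.PosSemidef := posSemidef_vecMulVec_self_star v
  have hMM : M * M = r • M := by
    rw [hM, vecMulVec_mul_vecMulVec, hr]
    ext i j; simp [vecMulVec_apply]; ring
  have hEp : (r⁻¹ • M).PosSemidef := (smul_nonneg (inv_pos.mpr hr0).le hMp.nonneg).posSemidef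
  have hEE : (r⁻¹ • M) * (r⁻¹ • M) = r⁻¹ • M := by
    rw [smul_mul_smul_comm, hMM, smul_smul, mul_assoc, inv_mul_cancel₀ hr0.ne', mul_one]
  have hE1 : (1 - r⁻¹ • M).PosSemidef := by
    have h := posSemidef_conjTranspose_mul_self (1 - r⁻¹ • M)
    rwa [conjTranspose_sub, conjTranspose_one, hEp.1.eq, mul_sub, sub_mul, sub_mul, hEE, one_mul,
      one_mul, mul_one, sub_self, sub_zero] at h
  have htr (N : Matrix B B ℂ) : (M * N).trace = star v ⬝ᵥ N *ᵥ v := by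
    rw [trace_mul_comm, hM, mul_vecMulVec, trace_vecMulVec, dotProduct_comm]
  have h := hε ρ σ hρ hσ _ hEp hE1
  simp only [smul_mul_assoc, trace_smul, htr, Complex.smul_re, smul_eq_mul, add_zero] at h
  rw [Complex.nonneg_iff]
  refine ⟨?_, (hH.im_star_dotProduct_mulVec_self v).symm⟩
  rw [sub_mulVec, smul_mulVec, dotProduct_sub, dotProduct_smul, Complex.sub_re, Complex.smul_re,
    smul_eq_mul, sub_nonneg]
  refine le_of_mul_le_mul_left (h.trans (le_of_eq ?_)) (inv_pos.mpr hr0)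
  ring

end Privacy

/-! ### Classical-quantum states -/

section ClassicalQuantum

open scoped MatrixOrder

variable {B X : Type*} [Fintype X]

lemma sum_smul_le {P : X → ℝ} (hP : P ∈ stdSimplex ℝ X) {ω : X → Matrix B B ℂ}
    {τ : Matrix B B ℂ} (h : ∀ x, ω x ≤ τ) : ∑ x, (P x : ℂ) • ω x ≤ τ := by
  have e : ∑ x, (P x : ℂ) • τ = τ := by
    rw [← Finset.sum_smul, ← Complex.ofReal_sum, hP.2, Complex.ofReal_one, one_smul]
  rw [← e]
  refine Finset.sum_le_sum fun x _ => ?_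
  rw [le_iff, ← smul_sub]
  exact (le_iff.mp (h x)).smul (by exact_mod_cast hP.1 x)

lemma smul_le_sum_smul {P : X → ℝ} (hP : P ∈ stdSimplex ℝ X) {ω : X → Matrix B B ℂ}
    {τ : Matrix B B ℂ} (h : ∀ x, τ ≤ ω x) : τ ≤ ∑ x, (P x : ℂ) • ω x := by
  have h' := sum_smul_le hP fun x => neg_le_neg (h x)
  simpa using h'

lemma traceFst_cqState [DecidableEq X] (P : X → ℝ) (ω : X → Matrix B B ℂ) :
    traceFst (cqState P ω) = ∑ x, (P x : ℂ) • ω x := by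
  ext b c
  simp only [traceFst, cqState, of_apply, Matrix.sum_apply, Matrix.smul_apply, kroneckerMap_apply,
    smul_eq_mul]
  rw [Finset.sum_comm]
  refine Finset.sum_congr rfl fun x _ => ?_
  simp [single_apply]

lemma smul_cqState [DecidableEq X] (c : ℝ) (P : X → ℝ) (ω : X → Matrix B B ℂ) :
    c • cqState P ω = cqState P fun x => c • ω x := by
  ext ⟨i, b⟩ ⟨j, d⟩
  simp only [cqState, kroneckerMap_apply, Matrix.sum_apply, Matrix.smul_apply, smul_eq_mul, Complex.real_smul,
    Finset.mul_sum]
  exact Finset.sum_congr rfl fun x _ => by ring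

variable [Fintype B]

lemma isState_sum_smul {P : X → ℝ} (hP : P ∈ stdSimplex ℝ X) {ω : X → Matrix B B ℂ}
    (hω : ∀ x, IsState (ω x)) : IsState (∑ x, (P x : ℂ) • ω x) := by
  constructor
  · exact posSemidef_sum _ fun x _ => (hω x).1.smul (by exact_mod_cast hP.1 x)
  · simp only [trace_sum, trace_smul, (hω _).2, smul_eq_mul, mul_one]
    exact_mod_cast hP.2

variable [DecidableEq X]

lemma traceSnd_cqState (P : X → ℝ) {ω : X → Matrix B B ℂ} (hω : ∀ x, (ω x).trace = 1) :
    traceSnd (cqState P ω) = ∑ x, (P x : ℂ) • Matrix.single x x 1 := by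
  ext i j
  simp only [traceSnd, cqState, of_apply, Matrix.sum_apply, Matrix.smul_apply, kroneckerMap_apply,
    smul_eq_mul]
  rw [Finset.sum_comm]
  refine Finset.sum_congr rfl fun x _ => ?_
  rw [← Finset.mul_sum, ← Finset.mul_sum]
  have := hω x
  simp only [trace, diag_apply] at this
  rw [this, mul_one]

/-- With the product of marginals again in classical-quantum form, operator comparison reduces to
single blocks. -/
lemma traceSnd_kronecker_traceFst_cqState (P : X → ℝ) {ω : X → Matrix B B ℂ}
    (hω : ∀ x, (ω x).trace = 1) :
    traceSnd (cqState P ω) ⊗ₖ traceFst (cqState P ω)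
      = cqState P fun _ => ∑ y, (P y : ℂ) • ω y := by
  rw [traceSnd_cqState P hω, traceFst_cqState]
  ext ⟨i, b⟩ ⟨j, c⟩
  simp only [cqState, kroneckerMap_apply, Matrix.sum_apply, Matrix.smul_apply, smul_eq_mul]
  rw [Finset.sum_mul]
  exact Finset.sum_congr rfl fun x _ => mul_assoc _ _ _

lemma cqState_mono {P : X → ℝ} (hP : ∀ x, 0 ≤ P x) {ω τ : X → Matrix B B ℂ}
    (h : ∀ x, ω x ≤ τ x) : cqState P ω ≤ cqState P τ := by
  refine Finset.sum_le_sum fun x _ => ?_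
  have e : Matrix.single x x (1 : ℂ) ⊗ₖ τ x - Matrix.single x x (1 : ℂ) ⊗ₖ ω x
      = Matrix.single x x (1 : ℂ) ⊗ₖ (τ x - ω x) := by
    ext; simp [mul_sub]
  rw [le_iff, ← smul_sub, e]
  have hs : (Matrix.single x x (1 : ℂ)).PosSemidef := by
    simpa using posSemidef_conjTranspose_mul_self (Matrix.single x x (1 : ℂ))
  exact (hs.kronecker (le_iff.mp (h x))).smul (by exact_mod_cast hP x)

lemma isState_cqState {P : X → ℝ} (hP : P ∈ stdSimplex ℝ X) {ω : X → Matrix B B ℂ}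
    (hω : ∀ x, IsState (ω x)) : IsState (cqState P ω) := by
  constructor
  · have h := cqState_mono hP.1 fun x => (hω x).1.nonneg
    have h0 : cqState P (fun _ => (0 : Matrix B B ℂ)) = 0 := by simp [cqState]
    exact (h0 ▸ h).posSemidef
  · simp only [cqState, trace_sum, trace_smul, trace_kronecker, (hω _).2, trace_single_eq_same,
      smul_eq_mul, mul_one]
    exact_mod_cast hP.2

/-- The Holevo information of an ensemble of states that are pairwise `e^ε`-comparable. -/
theorem holevoInformation_cqState_le [DecidableEq B] {P : X → ℝ} (hP : P ∈ stdSimplex ℝ X)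
    {ω : X → Matrix B B ℂ} (hω : ∀ x, IsState (ω x)) {ε : ℝ} (hε : 0 ≤ ε)
    (h : ∀ x y, ω x ≤ Real.exp ε • ω y) :
    holevoInformation (cqState P ω)
      ≤ ((ε * ((Real.exp ε - 1) / (Real.exp ε + 1)) : ℝ) : EReal) := by
  have hs : Real.exp ε • ∑ y, (P y : ℂ) • ω y = ∑ y, (P y : ℂ) • (Real.exp ε • ω y) := by
    simp only [Finset.smul_sum, smul_comm (Real.exp ε)]
  rw [holevoInformation, traceSnd_kronecker_traceFst_cqState P fun x => (hω x).2]
  refine relativeEntropy_le (isState_cqState hP hω)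
    (isState_cqState hP fun _ => isState_sum_smul hP hω) hε ?_ ?_
  · rw [smul_cqState]
    exact cqState_mono hP.1 fun x => hs ▸ smul_le_sum_smul hP (h x)
  · rw [smul_cqState]
    exact cqState_mono hP.1 fun x => sum_smul_le hP fun y => h y x

end ClassicalQuantum

lemma exp_sub_one_div_le {ε : ℝ} (hε : 0 ≤ ε) :
    (Real.exp ε - 1) / (Real.exp ε + 1) ≤ ε / 2 := by
  have hmono : MonotoneOn (fun t : ℝ => t / 2 * (Real.exp t + 1) - (Real.exp t - 1))
      (Set.Ici 0) := by
    refine monotoneOn_of_deriv_nonneg (convex_Ici 0) (by fun_prop) (by fun_prop) fun t ht => ?_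
    have hd : HasDerivAt (fun t : ℝ => t / 2 * (Real.exp t + 1) - (Real.exp t - 1))
        (1 / 2 * (Real.exp t + 1) + t / 2 * Real.exp t - Real.exp t) t :=
      (((hasDerivAt_id t).div_const 2).mul ((Real.hasDerivAt_exp t).add_const 1)).sub
        ((Real.hasDerivAt_exp t).sub_const 1)
    rw [hd.deriv]
    -- The derivative equals `e^t (e^{-t} - (1 - t)) / 2`.
    have h1 := Real.add_one_le_exp (-t)
    have h2 : Real.exp (-t) * Real.exp t = 1 := by rw [← Real.exp_add]; simp
    nlinarith [Real.exp_pos t]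
  have h := hmono Set.self_mem_Ici hε hε
  simp only [zero_div, zero_mul, Real.exp_zero, sub_self] at h
  rw [div_le_iff₀ (by positivity)]
  linarith

end QInfo

theorem mainTheorem10 {A B X : Type*} [Fintype A] [Fintype B] [DecidableEq B]
    [Fintype X] [DecidableEq X] (ε : ℝ) (hε : 0 ≤ ε) :
    (∀ 𝒜 : Matrix A A ℂ →ₗ[ℂ] Matrix B B ℂ, QInfo.IsChannel 𝒜 → QInfo.IsQLDP ε 0 𝒜 →
      ∀ P : X → ℝ, P ∈ stdSimplex ℝ X →
      ∀ ρ : X → Matrix A A ℂ, (∀ x, QInfo.IsState (ρ x)) →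
        QInfo.holevoInformation (QInfo.cqState P (fun x => 𝒜 (ρ x))) ≤
          ((ε * ((Real.exp ε - 1) / (Real.exp ε + 1)) : ℝ) : EReal)) ∧
    ε * ((Real.exp ε - 1) / (Real.exp ε + 1)) ≤ min ε (ε ^ 2 / 2) := by
  refine ⟨fun 𝒜 h𝒜 hpriv P hP ρ hρ => QInfo.holevoInformation_cqState_le hP
    (fun x => h𝒜.isState_apply (hρ x)) hε
    fun x y => QInfo.le_exp_smul_of_isQLDP h𝒜 hpriv (hρ x) (hρ y), le_min ?_ ?_⟩
  · refine mul_le_of_le_one_right hε ?_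
    rw [div_le_one (by positivity)]
    linarith
  · calc _ ≤ ε * (ε / 2) := mul_le_mul_of_nonneg_left (QInfo.exp_sub_one_div_le hε) hε
      _ = ε ^ 2 / 2 := by ring
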